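/- A transfinite word on a set $X$ is a map $w$ from an ordinal $|w|$ (its length) to $X$; $\epsilon$ is the empty word and $ww'$ denotes concatenation, of length $|w|+|w'|$. For $F\subseteq X$ and an ordinal $\gamma$, $F^{<\gamma}$ is the set of words of length $<\gamma$ with all letters in $F$; for sets of words, $A_1\cdots A_n$ is the set of all concatenations $u_1\cdots u_n$ with $u_i\in A_i$ (it is $\{\epsilon\}$ if $n=0$). If $X$ is a topological space, the regular subword topology on a set $Y$ of transfinite words is the coarsest topology in which all sets $(F_1^{<\alpha_1}\cdots F_n^{<\alpha_n})\cap Y$ are closed, where $n\in\mathbb N$, the $F_i$ are closed in $X$ and the $\alpha_i$ are ordinals. A bound is an ordinal of the form $\omega^\beta$ or $\omega^\beta+1$. The specialization preordering of a space $Y$ is: $y\le y'$ iff every open neighborhood of $y$ contains $y'$; $\eta_Y$ maps $y\in Y$ to $\{x\in Y\mid x\le y\}$, an irreducible closed subset of $Y$. Let $X$ be a Noetherian topological space (every open subset is compact) and let $\alpha$ be a bound. Give $X^{<\alpha}$ the regular subword topology; for $w\in X^{<\alpha}$ let $\overline w$ be the closure of $\{w\}$ in $X^{<\alpha}$, and let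 $\operatorname{supp} w$ be the closure in $X$ of the set of letters of $w$. A word $w\in X^{<\alpha}$ is topologically indecomposable if $w\ne\epsilon$ and, whenever $w=uv$ with $v\neq\epsilon$, $w\in\overline v$. Let $\preceq$ be the specialization preordering of $X^{<\alpha}$. Then: 1. Every $w\in X^{<\alpha}$ can be written as a finite concatenation $w=w_1\cdots w_n$ ($n\ge 0$) of topologically indecomposable words of $X^{<\alpha}$; and for every such decomposition, $\eta_{X^{<\alpha}}(w)=\overline w=\overline{w_1}\cdots\overline{w_n}$, and $\overline{w_i}=(\operatorname{supp} w_i)^{<|w_i|+1}$ for every $i$ with $1\le i\le n$. 2. For all $w,w'\in X^{<\alpha}$ written as finite concatenations $w=w_1\cdots w_m$ and $w'=w'_1\cdots w'_n$ of topologically indecomposable words of $X^{<\alpha}$, $w\preceq w'$ if and only if there are indices $0=i_0\le i_1\le\cdots\le i_{n-1}\le i_n=m$ such that for every $j$ with $1\le j\le n$, $\bigcup_{i=i_{j-1}+1}^{i_j}\operatorname{supp} w_i\subseteq\operatorname{supp} w'_j$ and $|w_{i_{j-1}+1}|+\cdots+|w_{i_j}|\le|w'_j|$ (ordinal sum, in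 this order). -/

import Mathlib

open scoped Ordinal

universe u v

/-- A transfinite word on `X`: an ordinal `length` together with a map from the ordinals
strictly below `length` to `X`. -/
structure TransfiniteWord (X : Type v) where
  length : Ordinal.{u}
  letter : (β : Ordinal.{u}) → β < length → X

namespace TransfiniteWord

variable {X : Type v}

/-- The empty word. -/
def empty : TransfiniteWord.{u, v} X where
  length := 0
  letter := fun β h => absurd h (not_lt_bot (a := β))

open Classical in
/-- The concatenation of `w` and `w'`: its letter at `β < |w|` is that of `w`, and its letter at
`|w| + β`, for `β < |w'|`, is the letter of `w'` at `β`. -/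
noncomputable def concat (w w' : TransfiniteWord.{u, v} X) : TransfiniteWord.{u, v} X where
  length := w.length + w'.length
  letter := fun β h =>
    if h₁ : β < w.length then w.letter β h₁
    else w'.letter (β - w.length) (by
      have h₂ : w.length + (β - w.length) = β := Ordinal.add_sub_cancel_of_le (not_lt.mp h₁)
      rw [← h₂] at h
      exact lt_of_add_lt_add_left h)

/-- The concatenation `w₁ ⋯ wₙ` of a finite sequence of words (the empty word if `n = 0`). -/
noncomputable def concatAll {n : ℕ} (w : Fin n → TransfiniteWord.{u, v} X) :
    TransfiniteWord.{u, v} X :=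
  (List.ofFn w).foldr concat empty

/-- The product `A₁ ⋯ Aₙ` of a finite sequence of sets of words, i.e. the set of concatenations
`w₁ ⋯ wₙ` with `wᵢ ∈ Aᵢ`. -/
def prodAll {n : ℕ} (A : Fin n → Set (TransfiniteWord.{u, v} X)) :
    Set (TransfiniteWord.{u, v} X) :=
  {w | ∃ u : Fin n → TransfiniteWord.{u, v} X, (∀ i, u i ∈ A i) ∧ w = concatAll u}

/-- `F^{<γ}`: the words of length strictly less than `γ` all of whose letters lie in `F`. -/
def wordsLT (F : Set X) (γ : Ordinal.{u}) : Set (TransfiniteWord.{u, v} X) :=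
  {w | w.length < γ ∧ ∀ β (h : β < w.length), w.letter β h ∈ F}

/-- The set of letters of a word. -/
def img (w : TransfiniteWord.{u, v} X) : Set X :=
  {x | ∃ β, ∃ h : β < w.length, w.letter β h = x}

/-- The support of a word: the closure of its set of letters. -/
def supp [TopologicalSpace X] (w : TransfiniteWord.{u, v} X) : Set X :=
  closure w.img

/-- The ordered ordinal sum `|w_a| + ⋯ + |w_{b-1}|` of the lengths of the words with (0-based)
index `k`, `a ≤ k < b`. -/
noncomputable def blockLength {m : ℕ} (w : Fin m → TransfiniteWord.{u, v} X) (a b : ℕ) :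
    Ordinal.{u} :=
  (((List.ofFn fun k => (w k).length).take b).drop a).sum

/-- The regular subword topology on a set `Y` of words: the coarsest topology for which all sets
`(F₁^{<α₁} ⋯ Fₙ^{<αₙ}) ∩ Y`, with `Fᵢ` closed in `X`, are closed. -/
instance regularSubwordTopology [TopologicalSpace X] (Y : Set (TransfiniteWord.{u, v} X)) :
    TopologicalSpace Y :=
  TopologicalSpace.generateFrom
    {U | ∃ (n : ℕ) (F : Fin n → Set X) (a : Fin n → Ordinal.{u}), (∀ i, IsClosed (F i)) ∧
      U = {w : Y | (w : TransfiniteWord.{u, v} X) ∈ prodAll fun i => wordsLT (F i) (a i)}ᶜ}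

/-- The set `X^{<α}` of all words on `X` of length strictly less than `α`. -/
abbrev below (X : Type v) (α : Ordinal.{u}) : Set (TransfiniteWord.{u, v} X) :=
  wordsLT Set.univ α

/-- Topological indecomposability in `X^{<α}`: `w` is non-empty and lies in the closure (in
`X^{<α}`) of each of its non-empty suffixes. -/
def IsTopIndecomposable [TopologicalSpace X] {α : Ordinal.{u}} (w : below X α) : Prop :=
  w.1 ≠ empty ∧
    ∀ u v : below X α, w.1 = concat u.1 v.1 → v.1 ≠ empty → w ∈ closure {v}

end TransfiniteWord

/-- A bound: an ordinal of the form `ω ^ β` or `ω ^ β + 1`. -/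
def IsOrdinalBound (α : Ordinal.{u}) : Prop :=
  ∃ β : Ordinal.{u}, α = ω ^ β ∨ α = ω ^ β + 1

/-- The specialization preordering: `x` is below `y` if every open neighborhood of `x`
contains `y`. -/
def SpecLE {Y : Type*} [TopologicalSpace Y] (x y : Y) : Prop :=
  ∀ U : Set Y, IsOpen U → x ∈ U → y ∈ U

theorem setOf_specLE {Y : Type*} [TopologicalSpace Y] (y : Y) :
    {x | SpecLE x y} = closure {y} := by
  ext x
  exact specializes_iff_forall_open.symm.trans specializes_iff_mem_closure

/-- The canonical map `y ↦ ↓ y` from a space to its sobrification, the space of its irreducible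
closed subsets. -/
def sobEta {Y : Type*} [TopologicalSpace Y] (y : Y) : TopologicalSpace.IrreducibleCloseds Y where
  carrier := {x | SpecLE x y}
  isIrreducible' := by rw [setOf_specLE]; exact isIrreducible_singleton.closure
  isClosed' := by rw [setOf_specLE]; exact isClosed_closure

open TransfiniteWord

/-! Topological indecomposability amounts to a combinatorial condition, `IsTailUniform`: passing to
a non-empty suffix loses neither length nor support. For a concatenation of such words, membership
in a closed set `F₁^{<a₁} ⋯ Fₙ^{<aₙ}` can be tested by cutting only between the words
(`splits_of_mem_prodAll`). A cut falling inside `rs` can be moved to the left end of `rs`: the block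
that begins with `s` accepts `rs` as well, since the two have the same length and support.

Membership thus depends only on the lengths and supports of the factors, and persists when these
shrink (`Splits.mono`). Hence the closure of `w₁ ⋯ wₘ` is the product of the sets `(supp
wᵢ)^{<|wᵢ|+1}`. The description of the specialization preordering is the same cutting criterion,
applied to that product for `w'`.

Decompositions exist because a non-empty suffix of least length, and then of least support, is
tail-uniform. Noetherianity makes the supports well-founded. The remaining prefix is strictly
shorter. -/

namespace TransfiniteWord

variable {X : Type v}

/-! ### Concatenation of transfinite words, and where a cut can fall -/

section Concat

theorem ext_letter {w w' : TransfiniteWord.{u, v} X} (h : w.length = w'.length)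
    (h' : ∀ β (h₁ : β < w.length) (h₂ : β < w'.length), w.letter β h₁ = w'.letter β h₂) :
    w = w' := by
  obtain ⟨l, f⟩ := w
  obtain ⟨l', f'⟩ := w'
  obtain rfl : l = l' := h
  congr
  funext β hβ
  exact h' β hβ hβ

theorem letter_congr {w w' : TransfiniteWord.{u, v} X} (h : w = w') {β β' : Ordinal.{u}}
    (hβ : β = β') (h₁ : β < w.length) (h₂ : β' < w'.length) :
    w.letter β h₁ = w'.letter β' h₂ := by
  subst h hβ
  rfl

@[simp] theorem length_empty : (empty : TransfiniteWord.{u, v} X).length = 0 := rfl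

@[simp] theorem length_concat (w w' : TransfiniteWord.{u, v} X) :
    (concat w w').length = w.length + w'.length := rfl

theorem eq_empty_iff {w : TransfiniteWord.{u, v} X} : w = empty ↔ w.length = 0 := by
  refine ⟨fun h => h ▸ rfl, fun h => ext_letter h fun β _ h₂ => absurd h₂ (not_lt_bot (a := β))⟩

theorem letter_concat_left (w w' : TransfiniteWord.{u, v} X) {β : Ordinal.{u}}
    (h : β < w.length) (h' : β < (concat w w').length) :
    (concat w w').letter β h' = w.letter β h :=
  dif_pos h

theorem letter_concat_right (w w' : TransfiniteWord.{u, v} X) {β : Ordinal.{u}}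
    (h : β < w'.length) (h' : w.length + β < (concat w w').length) :
    (concat w w').letter (w.length + β) h' = w'.letter β h := by
  have h₁ : ¬ w.length + β < w.length := not_lt.mpr le_self_add
  exact (dif_neg h₁).trans (letter_congr rfl (Ordinal.add_sub_cancel _ _) _ _)

theorem lt_or_exists_add {β γ : Ordinal.{u}} (δ : Ordinal.{u}) (h : β < γ + δ) :
    β < γ ∨ ∃ ε < δ, β = γ + ε := by
  rcases lt_or_ge β γ with h' | h'
  · exact .inl h'
  · refine .inr ⟨β - γ, ?_, (Ordinal.add_sub_cancel_of_le h').symm⟩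
    rw [← Ordinal.add_sub_cancel_of_le h'] at h
    exact lt_of_add_lt_add_left h

@[simp] theorem empty_concat (w : TransfiniteWord.{u, v} X) : concat empty w = w := by
  refine ext_letter (zero_add _) fun β h₁ h₂ => ?_
  have h₃ : empty.length (X := X) + β < (concat empty w).length := by simpa using h₂
  exact (letter_congr rfl (by simp) h₁ h₃).trans (letter_concat_right _ _ h₂ h₃)

@[simp] theorem concat_empty (w : TransfiniteWord.{u, v} X) : concat w empty = w :=
  ext_letter (add_zero _) fun _ h₁ h₂ => letter_concat_left w empty h₂ h₁

theorem concat_assoc (a b c : TransfiniteWord.{u, v} X) :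
    concat (concat a b) c = concat a (concat b c) := by
  refine ext_letter (add_assoc _ _ _) fun β h₁ h₂ => ?_
  rcases lt_or_exists_add _ h₁ with h | ⟨ε, hε, rfl⟩
  · rw [letter_concat_left _ _ h]
    rcases lt_or_exists_add _ h with h' | ⟨ε, hε, rfl⟩
    · rw [letter_concat_left _ _ h', letter_concat_left _ _ h']
    · rw [letter_concat_right _ _ hε, letter_concat_right _ _ (hε.trans_le le_self_add),
        letter_concat_left _ _ hε]
  · rw [letter_concat_right _ _ hε]
    have h₃ : a.length + (b.length + ε) < (concat a (concat b c)).length := by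
      simpa [add_assoc] using h₂
    have h₄ : b.length + ε < (concat b c).length := by simpa using hε
    rw [← letter_concat_right b c hε h₄, ← letter_concat_right a _ h₄ h₃]
    exact letter_congr rfl (add_assoc _ _ _).symm _ _

theorem concat_left_cancel {a b c : TransfiniteWord.{u, v} X} (h : concat a b = concat a c) :
    b = c := by
  have hl : b.length = c.length := add_left_cancel (congrArg length h)
  refine ext_letter hl fun β h₁ h₂ => ?_
  have h₃ : a.length + β < (concat a b).length := by simpa using h₁
  have h₄ : a.length + β < (concat a c).length := by simpa using h₂
  rw [← letter_concat_right a b h₁ h₃, ← letter_concat_right a c h₂ h₄]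
  exact letter_congr h rfl _ _

/-- The suffix of a word obtained by deleting its letters below `β`. -/
noncomputable def drop (w : TransfiniteWord.{u, v} X) (β : Ordinal.{u}) :
    TransfiniteWord.{u, v} X where
  length := w.length - β
  letter := fun γ h => w.letter (β + γ) (Ordinal.lt_sub.mp h)

/-- Levi's lemma for transfinite words. -/
theorem exists_eq_concat_of_length_le {x y u v : TransfiniteWord.{u, v} X}
    (h : concat x y = concat u v) (hl : u.length ≤ x.length) :
    ∃ s, x = concat u s ∧ v = concat s y := by
  have hx : x = concat u (x.drop u.length) := by
    refine ext_letter (Ordinal.add_sub_cancel_of_le hl).symm fun β h₁ h₂ => ?_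
    rcases lt_or_exists_add _ h₂ with h' | ⟨ε, hε, rfl⟩
    · have h₃ : β < (concat x y).length := h₁.trans_le le_self_add
      have h₄ : β < (concat u v).length := h'.trans_le le_self_add
      rw [letter_concat_left _ _ h', ← letter_concat_left x y h₁ h₃,
        ← letter_concat_left u v h' h₄]
      exact letter_congr h rfl _ _
    · rw [letter_concat_right _ _ hε]
      rfl
  refine ⟨_, hx, concat_left_cancel (a := u) ?_⟩
  rw [← h, ← concat_assoc, ← hx]

theorem img_concat (w w' : TransfiniteWord.{u, v} X) :
    (concat w w').img = w.img ∪ w'.img := by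
  ext x
  constructor
  · rintro ⟨β, h, rfl⟩
    rcases lt_or_exists_add _ h with h' | ⟨ε, hε, rfl⟩
    · exact .inl ⟨β, h', (letter_concat_left _ _ h' h).symm⟩
    · exact .inr ⟨ε, hε, (letter_concat_right _ _ hε h).symm⟩
  · rintro (⟨β, h, rfl⟩ | ⟨β, h, rfl⟩)
    · exact ⟨β, h.trans_le le_self_add, letter_concat_left _ _ h _⟩
    · exact ⟨w.length + β, by simpa using h, letter_concat_right _ _ h _⟩

/-- The concatenation of a list of words. -/
noncomputable def concatList (l : List (TransfiniteWord.{u, v} X)) : TransfiniteWord.{u, v} X :=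
  l.foldr concat empty

@[simp] theorem concatList_nil : concatList ([] : List (TransfiniteWord.{u, v} X)) = empty := rfl

@[simp] theorem concatList_cons (w : TransfiniteWord.{u, v} X) (l) :
    concatList (w :: l) = concat w (concatList l) := rfl

theorem concatList_append (l l' : List (TransfiniteWord.{u, v} X)) :
    concatList (l ++ l') = concat (concatList l) (concatList l') := by
  induction l with
  | nil => simp
  | cons w l ih => simp [ih, concat_assoc]

theorem length_concatList (l : List (TransfiniteWord.{u, v} X)) :
    (concatList l).length = (l.map length).sum := by
  induction l with
  | nil => rfl
  | cons w l ih => simp [ih]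

theorem img_concatList_subset_iff (l : List (TransfiniteWord.{u, v} X)) (F : Set X) :
    (concatList l).img ⊆ F ↔ ∀ w ∈ l, w.img ⊆ F := by
  induction l with
  | nil =>
    simp only [concatList_nil, List.not_mem_nil, false_imp_iff, implies_true, iff_true]
    rintro x ⟨β, h, -⟩
    exact absurd h (not_lt_bot (a := β))
  | cons w l ih => simp [img_concat, ih]

theorem length_le_length_concatList {l : List (TransfiniteWord.{u, v} X)}
    {w : TransfiniteWord.{u, v} X} (h : w ∈ l) : w.length ≤ (concatList l).length := by
  induction l with
  | nil => simp at h
  | cons x l ih =>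
    rcases List.mem_cons.mp h with rfl | h
    · exact le_self_add
    · exact (ih h).trans le_add_self

theorem mem_prodAll_zero {A : Fin 0 → Set (TransfiniteWord.{u, v} X)}
    {w : TransfiniteWord.{u, v} X} : w ∈ prodAll A ↔ w = empty :=
  ⟨fun ⟨_, _, h⟩ => h, fun h => ⟨Fin.elim0, fun i => i.elim0, h⟩⟩

theorem mem_prodAll_succ {n : ℕ} {A : Fin (n + 1) → Set (TransfiniteWord.{u, v} X)}
    {w : TransfiniteWord.{u, v} X} :
    w ∈ prodAll A ↔ ∃ u ∈ A 0, ∃ v ∈ prodAll (Fin.tail A), w = concat u v := by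
  constructor
  · rintro ⟨u, hu, rfl⟩
    exact ⟨u 0, hu 0, _, ⟨Fin.tail u, fun i => hu i.succ, rfl⟩, by
      simp only [concatAll, List.ofFn_succ]; rfl⟩
  · rintro ⟨u, hu, _, ⟨v, hv, rfl⟩, rfl⟩
    refine ⟨Fin.cons u v, Fin.cases hu hv, by simp [concatAll, List.ofFn_succ]⟩

/-- Either the second factor of a product of words is empty, or the cut between the two factors
happens inside one of the words, or at its left end. -/
theorem exists_cut {l : List (TransfiniteWord.{u, v} X)} {u v : TransfiniteWord.{u, v} X}
    (h : concatList l = concat u v) :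
    v = empty ∨ ∃ l₁ r s l₂, l = l₁ ++ concat r s :: l₂ ∧ s ≠ empty ∧
      u = concat (concatList l₁) r ∧ v = concat s (concatList l₂) := by
  induction l generalizing u with
  | nil =>
    left
    have := congrArg length h
    simp only [concatList_nil, length_empty, length_concat] at this
    rw [eq_empty_iff]
    exact le_antisymm (le_add_self.trans this.ge) zero_le
  | cons x l ih =>
    rw [concatList_cons] at h
    rcases lt_or_ge u.length x.length with hl | hl
    · obtain ⟨s, rfl, rfl⟩ := exists_eq_concat_of_length_le h hl.le
      refine .inr ⟨[], u, s, l, rfl, ?_, by simp, rfl⟩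
      rintro rfl
      simp at hl
    · obtain ⟨u', rfl, h'⟩ := exists_eq_concat_of_length_le h.symm hl
      rcases ih h' with hv | ⟨l₁, r, s, l₂, rfl, hs, rfl, rfl⟩
      · exact .inl hv
      · exact .inr ⟨x :: l₁, r, s, l₂, rfl, hs, by simp [concat_assoc], rfl⟩

end Concat

/-! ### Supports, tail-uniform words and cuts at word boundaries -/

section Supp

variable [TopologicalSpace X]

theorem supp_subset_iff {w : TransfiniteWord.{u, v} X} {F : Set X} (hF : IsClosed F) :
    w.supp ⊆ F ↔ w.img ⊆ F :=
  hF.closure_subset_iff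

theorem mem_wordsLT_iff {w : TransfiniteWord.{u, v} X} {F : Set X} (hF : IsClosed F)
    {γ : Ordinal.{u}} : w ∈ wordsLT F γ ↔ w.length < γ ∧ w.supp ⊆ F := by
  rw [supp_subset_iff hF]
  refine and_congr_right fun _ => ⟨?_, fun h β hβ => h ⟨β, hβ, rfl⟩⟩
  rintro h x ⟨β, hβ, rfl⟩
  exact h β hβ

theorem isClosed_supp (w : TransfiniteWord.{u, v} X) : IsClosed w.supp := isClosed_closure

theorem supp_right_subset (w w' : TransfiniteWord.{u, v} X) :
    w'.supp ⊆ (concat w w').supp :=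
  closure_mono (img_concat w w' ▸ Set.subset_union_right)

theorem concatList_mem_wordsLT_iff {l : List (TransfiniteWord.{u, v} X)} {F : Set X}
    (hF : IsClosed F) {γ : Ordinal.{u}} :
    concatList l ∈ wordsLT F γ ↔ (∀ w ∈ l, w.supp ⊆ F) ∧ (l.map length).sum < γ := by
  rw [mem_wordsLT_iff hF, supp_subset_iff hF, img_concatList_subset_iff, length_concatList,
    and_comm]
  simp only [supp_subset_iff hF]

/-- `u` is no longer than `w` and has smaller support. -/
def SuppLE (u w : TransfiniteWord.{u, v} X) : Prop :=
  u.length ≤ w.length ∧ u.supp ⊆ w.supp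

theorem SuppLE.refl (w : TransfiniteWord.{u, v} X) : SuppLE w w := ⟨le_rfl, subset_rfl⟩

theorem mem_wordsLT_supp_iff {u w : TransfiniteWord.{u, v} X} :
    u ∈ wordsLT w.supp (w.length + 1) ↔ SuppLE u w := by
  rw [mem_wordsLT_iff (isClosed_supp w), Order.lt_add_one_iff]
  rfl

/-- A non-empty word all of whose non-empty suffixes have the same length and support as itself. -/
def IsTailUniform (w : TransfiniteWord.{u, v} X) : Prop :=
  w ≠ empty ∧ ∀ u v, w = concat u v → v ≠ empty → SuppLE w v

/-- A suffix of `w` is a suffix of the whole word, which dominates `w` in length and support. -/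
theorem IsTailUniform.of_concat {u w : TransfiniteWord.{u, v} X}
    (h : IsTailUniform (concat u w)) (hw : w ≠ empty) : IsTailUniform w := by
  refine ⟨hw, fun a b hab hb => ?_⟩
  obtain ⟨h₁, h₂⟩ := h.2 (concat u a) b (by rw [hab, concat_assoc]) hb
  exact ⟨le_add_self.trans h₁, (supp_right_subset u w).trans h₂⟩

/-- A list of words can be cut into `n` consecutive blocks, the `j`th one having support in `F j`
and length below `a j`. -/
def Splits : (n : ℕ) → List (TransfiniteWord.{u, v} X) → (Fin n → Set X) →
    (Fin n → Ordinal.{u}) → Prop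
  | 0, l, _, _ => l = []
  | n + 1, l, F, a => ∃ k ≤ l.length, (∀ w ∈ l.take k, w.supp ⊆ F 0) ∧
      ((l.take k).map length).sum < a 0 ∧ Splits n (l.drop k) (Fin.tail F) (Fin.tail a)

/-- The same cut positions work: the constraints are upper bounds, and ordinal sums are weakly
monotone in every summand. -/
theorem Splits.mono {n : ℕ} {l l' : List (TransfiniteWord.{u, v} X)} {F : Fin n → Set X}
    {a : Fin n → Ordinal.{u}} (h : Splits n l F a) (hl : List.Forall₂ SuppLE l' l) :
    Splits n l' F a := by
  induction n generalizing l l' with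
  | zero =>
    obtain rfl : l = [] := h
    exact List.forall₂_nil_right_iff.mp hl
  | succ n ih =>
    obtain ⟨k, hk, hs, ha, h⟩ := h
    have ht := List.forall₂_take k hl
    refine ⟨k, hl.length_eq ▸ hk, fun w hw => ?_, lt_of_le_of_lt ?_ ha,
      ih h (List.forall₂_drop k hl)⟩
    · obtain ⟨i, hi, rfl⟩ := List.getElem_of_mem hw
      have hi' : i < (l.take k).length := ht.length_eq ▸ hi
      exact ((ht.get hi hi').2).trans (hs _ (List.getElem_mem hi'))
    · refine List.Forall₂.sum_le_sum ?_
      rw [List.forall₂_map_left_iff, List.forall₂_map_right_iff]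
      exact ht.imp fun _ _ h => h.1

theorem Splits.mem_prodAll {n : ℕ} {l : List (TransfiniteWord.{u, v} X)} {F : Fin n → Set X}
    {a : Fin n → Ordinal.{u}} (h : Splits n l F a) (hF : ∀ i, IsClosed (F i)) :
    concatList l ∈ prodAll fun i => wordsLT (F i) (a i) := by
  induction n generalizing l with
  | zero =>
    obtain rfl : l = [] := h
    exact mem_prodAll_zero.mpr rfl
  | succ n ih =>
    obtain ⟨k, hk, hs, ha, h⟩ := h
    exact mem_prodAll_succ.mpr ⟨_, (concatList_mem_wordsLT_iff (hF 0)).mpr ⟨hs, ha⟩, _,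
      ih h fun i => hF i.succ, by rw [← concatList_append, List.take_append_drop]⟩

/-- The heart of the proof: tail-uniformity lets every cut slide to a boundary between words. -/
theorem splits_of_mem_prodAll {n : ℕ} {l : List (TransfiniteWord.{u, v} X)} {F : Fin n → Set X}
    {a : Fin n → Ordinal.{u}} (hl : ∀ w ∈ l, IsTailUniform w) (hF : ∀ i, IsClosed (F i))
    (h : concatList l ∈ prodAll fun i => wordsLT (F i) (a i)) : Splits n l F a := by
  induction n generalizing l with
  | zero =>
    rw [mem_prodAll_zero] at h
    cases l with
    | nil => rfl
    | cons w l =>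
      refine absurd (eq_empty_iff.mpr ?_) (hl w (by simp)).1
      exact le_antisymm ((length_le_length_concatList (by simp)).trans
        (eq_empty_iff.mp h).le) zero_le
  | succ n ih =>
    obtain ⟨u, hu, v, hv, h⟩ := mem_prodAll_succ.mp h
    -- If nothing is left after the first factor, the first block takes the whole list and the
    -- others split `[]`.
    rcases exists_cut h with rfl | ⟨l₁, r, s, l₂, rfl, hs, rfl, rfl⟩
    · rw [concat_empty] at h
      obtain ⟨h₁, h₂⟩ := (concatList_mem_wordsLT_iff (hF 0)).mp (h ▸ hu)
      refine ⟨l.length, le_rfl, by simpa using h₁, by simpa using h₂, ?_⟩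
      rw [List.drop_length]
      exact ih (l := []) (by simp) (fun i => hF i.succ) hv
    · have hrs : IsTailUniform (concat r s) := hl _ (by simp)
      have hu' : concatList l₁ ∈ wordsLT (F 0) (a 0) :=
        ⟨le_self_add.trans_lt hu.1, fun β hβ => by
          have := hu.2 β (hβ.trans_le le_self_add)
          rwa [letter_concat_left _ _ hβ] at this⟩
      obtain ⟨h₁, h₂⟩ := (concatList_mem_wordsLT_iff (hF 0)).mp hu'
      -- The cut moves to the left end of `rs`, so the first block only gets shorter.
      refine ⟨l₁.length, by simp, by simpa using h₁, by simpa using h₂, ?_⟩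
      rw [List.drop_left]
      -- Induction splits `s :: l₂`; putting `r` back in front of `s` is harmless because `SuppLE
      -- (concat r s) s`.
      refine (ih (l := s :: l₂) ?_ (fun i => hF i.succ) hv).mono
        (.cons (hrs.2 r s rfl hs) (List.forall₂_same.mpr fun w _ => SuppLE.refl w))
      intro w hw
      rcases List.mem_cons.mp hw with rfl | hw
      · exact hrs.of_concat hs
      · exact hl w (by simp [hw])

theorem splits_iff_exists_indices {n : ℕ} {l : List (TransfiniteWord.{u, v} X)}
    {F : Fin n → Set X} {a : Fin n → Ordinal.{u}} :
    Splits n l F a ↔ ∃ idx : Fin (n + 1) → ℕ, idx 0 = 0 ∧ Monotone idx ∧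
      idx (Fin.last n) = l.length ∧ ∀ j : Fin n,
        (∀ w ∈ (l.take (idx j.succ)).drop (idx j.castSucc), w.supp ⊆ F j) ∧
        (((l.take (idx j.succ)).drop (idx j.castSucc)).map length).sum < a j := by
  have key (l : List (TransfiniteWord.{u, v} X)) (k b c : ℕ) :
      (l.take (k + c)).drop (k + b) = ((l.drop k).take c).drop b := by
    rw [← List.drop_drop, List.drop_take, Nat.add_sub_cancel_left]
  induction n generalizing l with
  | zero =>
    constructor
    · rintro (rfl : l = [])
      exact ⟨fun _ => 0, rfl, fun _ _ _ => le_rfl, rfl, fun j => j.elim0⟩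
    · rintro ⟨idx, h₀, -, h, -⟩
      exact List.eq_nil_of_length_eq_zero (h.symm.trans h₀)
  | succ n ih =>
    constructor
    · rintro ⟨k, hk, hs, ha, h⟩
      obtain ⟨idx, h₀, hm, hlast, h⟩ := ih.mp h
      refine ⟨Fin.cons 0 fun j => k + idx j, rfl, ?_, ?_, ?_⟩
      · intro i j hij
        induction i using Fin.cases with
        | zero => exact Nat.zero_le _
        | succ i =>
          induction j using Fin.cases with
          | zero => exact absurd hij (by simp)
          | succ j => simpa using hm (Fin.succ_le_succ_iff.mp hij)
      · rw [← Fin.succ_last, Fin.cons_succ, hlast, List.length_drop]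
        omega
      · intro j
        induction j using Fin.cases with
        | zero => simpa [h₀] using And.intro hs (by simpa using ha)
        | succ j =>
          rw [← Fin.succ_castSucc, Fin.cons_succ, Fin.cons_succ, key]
          exact h j
    · rintro ⟨idx, h₀, hm, hlast, h⟩
      have hle : idx 1 ≤ l.length := hlast ▸ hm (Fin.le_last 1)
      have hi (j : Fin (n + 1)) : idx 1 + (idx j.succ - idx 1) = idx j.succ :=
        Nat.add_sub_cancel' (hm (Fin.succ_le_succ_iff.mpr (Fin.zero_le j)))
      refine ⟨idx 1, hle, ?_, ?_, ih.mpr ⟨fun j => idx j.succ - idx 1, ?_, ?_, ?_, fun j => ?_⟩⟩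
      · simpa [h₀] using (h 0).1
      · simpa [h₀] using (h 0).2
      · simp
      · exact fun i j hij => Nat.sub_le_sub_right (hm (Fin.succ_le_succ_iff.mpr hij)) _
      · simp [hlast]
      · have := h j.succ
        rw [← Fin.succ_castSucc, ← hi j.succ, ← hi j.castSucc, key] at this
        exact this

end Supp

/-! ### Closures of points and existence of decompositions -/

section Closure

variable [TopologicalSpace X] {α : Ordinal.{u}}

/-- Testing the generating closed sets suffices, as the implication passes to finite intersections
and unions of opens. -/
theorem mem_closure_singleton_iff {Y : Set (TransfiniteWord.{u, v} X)} {w w' : Y} :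
    w ∈ closure {w'} ↔ ∀ (n : ℕ) (F : Fin n → Set X) (a : Fin n → Ordinal.{u}),
      (∀ i, IsClosed (F i)) → w'.1 ∈ prodAll (fun i => wordsLT (F i) (a i)) →
        w.1 ∈ prodAll fun i => wordsLT (F i) (a i) := by
  rw [← setOf_specLE, Set.mem_ofPred_eq]
  constructor
  · intro h n F a hF hw'
    by_contra hw
    exact h _ (TopologicalSpace.isOpen_generateFrom_of_mem ⟨n, F, a, hF, rfl⟩) hw hw'
  · intro h U hU
    induction hU with
    | basic U hU =>
      obtain ⟨n, F, a, hF, rfl⟩ := hU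
      exact mt (h n F a hF)
    | univ => exact id
    | inter _ _ _ _ h₁ h₂ => exact And.imp h₁ h₂
    | sUnion _ _ ih => exact fun ⟨U, hU, hw⟩ => ⟨U, hU, ih U hU hw⟩

theorem mem_prodAll_suppLE_iff {m : ℕ} {p : Fin m → TransfiniteWord.{u, v} X}
    {x : TransfiniteWord.{u, v} X} :
    x ∈ prodAll (fun i => wordsLT (p i).supp ((p i).length + 1)) ↔
      ∃ l, List.Forall₂ SuppLE l (List.ofFn p) ∧ x = concatList l := by
  constructor
  · rintro ⟨q, hq, rfl⟩
    refine ⟨List.ofFn q, ?_, rfl⟩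
    rw [List.forall₂_iff_get]
    exact ⟨by simp, fun i _ _ => by simpa using mem_wordsLT_supp_iff.mp (hq _)⟩
  · rintro ⟨l, hl, rfl⟩
    obtain rfl : l.length = m := by simpa using hl.length_eq
    refine ⟨l.get, fun i => mem_wordsLT_supp_iff.mpr ?_, by simp [concatAll, concatList]⟩
    simpa using hl.get i.2 (by simp)

/-- The closure of a concatenation of tail-uniform words. -/
theorem image_closure_concatAll {m : ℕ} {p : Fin m → TransfiniteWord.{u, v} X}
    (hp : ∀ i, IsTailUniform (p i)) {w : below X α} (hw : w.1 = concatAll p) :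
    Subtype.val '' closure {w} = prodAll fun i => wordsLT (p i).supp ((p i).length + 1) := by
  have hw' : w.1 = concatList (List.ofFn p) := hw
  ext x
  constructor
  -- The right-hand side is itself one of the generating closed sets, and it contains `w`.
  · rintro ⟨x, hx, rfl⟩
    exact mem_closure_singleton_iff.mp hx _ _ _ (fun i => isClosed_supp _)
      ⟨p, fun i => mem_wordsLT_supp_iff.mpr (SuppLE.refl _), hw⟩
  · intro hx
    obtain ⟨l, hl, rfl⟩ := mem_prodAll_suppLE_iff.mp hx
    have hlen : (concatList l).length ≤ w.1.length := by
      rw [hw', length_concatList, length_concatList]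
      refine List.Forall₂.sum_le_sum ?_
      rw [List.forall₂_map_left_iff, List.forall₂_map_right_iff]
      exact hl.imp fun _ _ h => h.1
    refine ⟨⟨concatList l, hlen.trans_lt w.2.1, fun _ _ => trivial⟩, ?_, rfl⟩
    rw [mem_closure_singleton_iff]
    intro n F a hF h
    rw [hw'] at h
    exact ((splits_of_mem_prodAll (by simpa [List.mem_ofFn] using hp) hF h).mono hl).mem_prodAll hF

theorem image_closure_of_isTailUniform {w : below X α} (hw : IsTailUniform w.1) :
    Subtype.val '' closure {w} = wordsLT w.1.supp (w.1.length + 1) := by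
  rw [image_closure_concatAll (p := fun _ : Fin 1 => w.1) (fun _ => hw) (by simp [concatAll])]
  ext x
  simp [mem_prodAll_succ, mem_prodAll_zero]

theorem isTopIndecomposable_iff {w : below X α} :
    IsTopIndecomposable w ↔ IsTailUniform w.1 := by
  refine and_congr_right fun _ => ⟨fun h u v huv hv => ?_, fun h u v huv hv => ?_⟩
  · have hlu : u.length < α := lt_of_le_of_lt (huv ▸ le_self_add) w.2.1
    have hlv : v.length < α := lt_of_le_of_lt (huv ▸ le_add_self) w.2.1
    have hw := h ⟨u, hlu, fun _ _ => trivial⟩ ⟨v, hlv, fun _ _ => trivial⟩ huv hv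
    -- The one-factor closed set `(supp v)^{<|v|+1}` contains `v`, hence `w`.
    have := mem_closure_singleton_iff.mp hw 1 (fun _ => v.supp) (fun _ => v.length + 1)
      (fun _ => isClosed_supp v)
      ⟨fun _ => v, fun _ => mem_wordsLT_supp_iff.mpr (SuppLE.refl v), by simp [concatAll]⟩
    simpa [mem_prodAll_succ, mem_prodAll_zero, mem_wordsLT_supp_iff] using this
  · have hw : IsTailUniform w.1 := ⟨by assumption, h⟩
    have hv' : IsTailUniform v.1 := (huv ▸ hw).of_concat hv
    have : w.1 ∈ Subtype.val '' closure {v} := by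
      rw [image_closure_of_isTailUniform hv', mem_wordsLT_supp_iff]
      exact h _ _ huv hv
    simpa using this

theorem exists_isTailUniform_suffix [TopologicalSpace.NoetherianSpace X]
    {w : TransfiniteWord.{u, v} X} (hw : w ≠ empty) :
    ∃ u v, w = concat u v ∧ IsTailUniform v := by
  -- Length and support can only decrease along suffixes, so at a lexicographic minimum neither
  -- changes.
  let f : TransfiniteWord.{u, v} X → Ordinal.{u} ×ₗ TopologicalSpace.Closeds X :=
    fun v => toLex (v.length, ⟨v.supp, isClosed_supp v⟩)
  have hwf : WellFounded fun a b => f a < f b := InvImage.wf f wellFounded_lt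
  obtain ⟨v, ⟨⟨u, huv⟩, hv⟩, hmin⟩ :=
    hwf.has_min {v | (∃ u, w = concat u v) ∧ v ≠ empty} ⟨w, ⟨empty, by simp⟩, hw⟩
  refine ⟨u, v, huv, hv, fun a b hab hb => ?_⟩
  have h := hmin b ⟨⟨concat u a, by rw [huv, hab, concat_assoc]⟩, hb⟩
  have hlen : v.length ≤ b.length := by
    by_contra! hlt
    exact h (Prod.Lex.toLex_lt_toLex.mpr (.inl hlt))
  refine ⟨hlen, ?_⟩
  by_contra hsub
  refine h (Prod.Lex.toLex_lt_toLex.mpr (.inr ⟨le_antisymm ?_ hlen, ?_⟩))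
  · exact hab ▸ le_add_self
  · exact lt_of_le_not_ge (show b.supp ⊆ v.supp from hab ▸ supp_right_subset a b) hsub

theorem exists_eq_concatList [TopologicalSpace.NoetherianSpace X]
    (w : TransfiniteWord.{u, v} X) :
    ∃ l, (∀ x ∈ l, IsTailUniform x) ∧ w = concatList l := by
  induction h : w.length using WellFoundedLT.induction generalizing w with
  | ind δ ih =>
    by_cases hw : w = empty
    · exact ⟨[], by simp, hw⟩
    · obtain ⟨u, v, rfl, hv⟩ := exists_isTailUniform_suffix hw
      have hlt : u.length < δ := by
        rw [← h, length_concat]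
        exact lt_add_of_pos_right _ (pos_of_ne_zero fun h => hv.1 (eq_empty_iff.mpr h))
      obtain ⟨l, hl, hu⟩ := ih _ hlt u rfl
      refine ⟨l ++ [v], ?_, by simp [concatList_append, ← hu]⟩
      intro x hx
      rcases List.mem_append.mp hx with hx | hx
      · exact hl x hx
      · rwa [List.mem_singleton.mp hx]

end Closure

end TransfiniteWord

/-! ### The main theorem -/

open TransfiniteWord
theorem mainTheorem2 {X : Type v} [TopologicalSpace X] [TopologicalSpace.NoetherianSpace X]
    (α : Ordinal.{u}) (hα : IsOrdinalBound α) :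
    -- (1) existence of a decomposition, and the closure computed from any decomposition
    (∀ w : below X α,
      (∃ (n : ℕ) (p : Fin n → below X α),
        (∀ i, IsTopIndecomposable (p i)) ∧ w.1 = concatAll fun i => (p i).1) ∧
      (∀ (n : ℕ) (p : Fin n → below X α),
        (∀ i, IsTopIndecomposable (p i)) → w.1 = concatAll (fun i => (p i).1) →
          (sobEta w : Set (below X α)) = closure {w} ∧
          Subtype.val '' closure {w} = prodAll (fun i => Subtype.val '' closure {p i}) ∧
          ∀ i, Subtype.val '' closure {p i} = wordsLT (supp (p i).1) ((p i).1.length + 1))) ∧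
    -- (2) the specialization preordering
    (∀ (w w' : below X α) (m n : ℕ) (p : Fin m → below X α) (p' : Fin n → below X α),
      (∀ i, IsTopIndecomposable (p i)) → w.1 = concatAll (fun i => (p i).1) →
      (∀ j, IsTopIndecomposable (p' j)) → w'.1 = concatAll (fun j => (p' j).1) →
      (SpecLE w w' ↔
        ∃ idx : Fin (n + 1) → ℕ, idx 0 = 0 ∧ Monotone idx ∧ idx (Fin.last n) = m ∧
          ∀ j : Fin n,
            (⋃ (k : Fin m) (_ : idx j.castSucc ≤ k ∧ k < idx j.succ), supp (p k).1)
              ⊆ supp (p' j).1 ∧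
            blockLength (fun k => (p k).1) (idx j.castSucc) (idx j.succ) ≤ (p' j).1.length)) := by
  simp only [isTopIndecomposable_iff]
  refine ⟨fun w => ⟨?_, fun n p hp hw => ⟨setOf_specLE w, ?_, fun i =>
    image_closure_of_isTailUniform (hp i)⟩⟩, fun w w' m n p p' hp hw hp' hw' => ?_⟩
  · obtain ⟨l, hl, hw⟩ := exists_eq_concatList w.1
    refine ⟨l.length, fun i => ⟨l.get i, lt_of_le_of_lt ?_ w.2.1, fun _ _ => trivial⟩,
      fun i => hl _ (l.get_mem i), ?_⟩
    · rw [hw]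
      exact length_le_length_concatList (l.get_mem i)
    · refine hw.trans ?_
      simp [concatAll, concatList]
  · simp only [image_closure_of_isTailUniform (hp _)]
    exact image_closure_concatAll hp hw
  -- Being below `w'` means lying in its closure, a product to which the cutting criterion for `w`
  -- applies.
  · have hmem : SpecLE w w' ↔
        w.1 ∈ prodAll fun j => wordsLT (p' j).1.supp ((p' j).1.length + 1) := by
      rw [← image_closure_concatAll hp' hw', ← setOf_specLE]
      simp
    have hw₁ : w.1 = concatList (List.ofFn fun i => (p i).1) := hw
    have hF (j : Fin n) : IsClosed (p' j).1.supp := isClosed_supp _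
    rw [hmem, hw₁, show (concatList (List.ofFn fun i => (p i).1) ∈ _) ↔ _ from
      ⟨splits_of_mem_prodAll (by simpa [List.mem_ofFn] using hp) hF, fun h => h.mem_prodAll hF⟩,
      splits_iff_exists_indices]
    refine exists_congr fun idx => and_congr_right fun _ => and_congr_right fun hm => ?_
    rw [List.length_ofFn]
    refine and_congr_right fun hlast => forall_congr' fun j => and_congr ?_ ?_
    · simp only [Set.iUnion_subset_iff, List.mem_iff_getElem, List.getElem_drop,
        List.getElem_take, List.getElem_ofFn, List.length_drop, List.length_take,
        List.length_ofFn]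
      constructor
      · intro h k hk
        -- Dropping the earlier blocks shifts positions by `idx j.castSucc`.
        refine h _ ⟨k - idx j.castSucc, by have := k.2; omega, ?_⟩
        congr 2
        exact Fin.ext (Nat.add_sub_cancel' hk.1)
      · rintro h _ ⟨i, hi, rfl⟩
        exact h _ ⟨by simp, by simp only; omega⟩
    · rw [Order.lt_add_one_iff, blockLength, List.map_drop, List.map_take, List.map_ofFn]
      rfl
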